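/- Let $K$ be a field, $R=K[x,y,z]$, and let $a,b,c,\alpha,\beta,\gamma$ be non-negative integers with $\alpha<a$, $\beta<b$, $\gamma<c$ and at most one of $\alpha,\beta,\gamma$ equal to zero. Assume $a+b+c+\alpha+\beta+\gamma\equiv 0 \pmod 3$ and put $$s=\tfrac13(a+b+c+\alpha+\beta+\gamma)-2,\quad A=s+2-a,\quad B=s+2-b,\quad C=s+2-c,\quad M=s+2-(\alpha+\beta+\gamma).$$ Assume further that $0\le M$, $0\le A\le\beta+\gamma$, $0\le B\le\alpha+\gamma$ and $0\le C\le\alpha+\beta$. Let $I=(x^a,y^b,z^c,x^\alpha y^\beta z^\gamma)\subset R$, and for each $d$ let the monomial basis of $[R/I]_d$ consist of the monomials of degree $d$ not in $I$. In the triangular lattice whose points are the triples of non-negative integers with sum $s+2$, assign to a monomial $x^iy^jz^k$ of degree $s+1$ the unit triangle with vertices $(i+1,j,k),(i,j+1,k),(i,j,k+1)$, and to a monomial $x^iy^jz^k$ of degree $s$ the unit triangle with vertices $(i,j+1,k+1),(i+1,j,k+1),(i+1,j+1,k)$. Let $H$ be the region formed by the unit triangles of the monomials in the bases of $[R/I]_s$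 and $[R/I]_{s+1}$; it is a hexagon with side-lengths $A,B+M,C,A+M,B,C+M$ (in cyclic order) from which a triangular puncture of side-length $M$ has been removed. A lozenge is the union of two unit triangles that share an edge; a lozenge tiling of $H$ is a set of lozenges in $H$ such that each unit triangle of $H$ is covered by exactly one of them. Then $[R/I]_s$ and $[R/I]_{s+1}$ have monomial bases $m_1,\dots,m_h$ and $n_1,\dots,n_h$ of the same size $h$. List both in lexicographic order, and let $Z$ be the $h\times h$ integer matrix with $Z_{i,j}=1$ if $m_i$ divides $n_j$ and $Z_{i,j}=0$ otherwise. The permanent of $Z$ is the number of lozenge tilings of $H$, and if $M$ is even, then $$\operatorname{per} Z=|\det Z|.$$ -/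

import Mathlib

namespace PuncturedHexagon

open MvPolynomial

/-- The ideal `(x^a, y^b, z^c, x^α y^β z^γ)` of `K[x,y,z]`. -/
noncomputable def aciIdeal (K : Type*) [Field K] (a b c α β γ : ℕ) : Ideal (MvPolynomial (Fin 3) K) :=
  Ideal.span {X 0 ^ a, X 1 ^ b, X 2 ^ c, X 0 ^ α * X 1 ^ β * X 2 ^ γ}

open Classical in
/-- The exponent vectors of the monomial basis of `[R/I]_d`, for `R = K[x,y,z]` and a monomial
ideal `I`: the monomials of degree `d` that do not lie in `I`. -/
noncomputable def basisMonomials {K : Type*} [Field K] (I : Ideal (MvPolynomial (Fin 3) K))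
    (d : ℕ) : Finset (Fin 3 →₀ ℕ) :=
  {m ∈ Finset.finsuppAntidiag Finset.univ d | monomial m (1 : K) ∉ I}

/-- The number of elements of the monomial basis of `[R/I]_d`. -/
noncomputable def hilb {K : Type*} [Field K] (I : Ideal (MvPolynomial (Fin 3) K)) (d : ℕ) : ℕ :=
  (basisMonomials I d).card

/-- The `i`-th element of the monomial basis of `[R/I]_d` in lexicographic order. -/
noncomputable def basisMonomial {K : Type*} [Field K] (I : Ideal (MvPolynomial (Fin 3) K))
    (d : ℕ) (i : Fin (hilb I d)) : Fin 3 →₀ ℕ :=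
  ofLex (((basisMonomials I d).map toLex.toEmbedding).orderEmbOfFin
    (Finset.card_map toLex.toEmbedding) i)

open Classical in
/-- The zero-one matrix whose `(i,j)` entry is `1` iff the `j`-th basis monomial of `[R/I]_{d+1}`
is a multiple of the `i`-th basis monomial of `[R/I]_d`.  For exponent vectors, divisibility is
the coordinatewise order. -/
noncomputable def zRect {K : Type*} [Field K] (I : Ideal (MvPolynomial (Fin 3) K)) (d : ℕ) :
    Matrix (Fin (hilb I d)) (Fin (hilb I (d + 1))) ℤ :=
  Matrix.of fun i j => if basisMonomial I d i ≤ basisMonomial I (d + 1) j then 1 else 0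

/-- The same matrix, as a square matrix of size `h_d`, when `h_{d+1} = h_d`. -/
noncomputable def zMatrix {K : Type*} [Field K] (I : Ideal (MvPolynomial (Fin 3) K)) (d : ℕ)
    (h : hilb I (d + 1) = hilb I d) : Matrix (Fin (hilb I d)) (Fin (hilb I d)) ℤ :=
  (zRect I d).submatrix id (Fin.cast h.symm)

/-!
The triangular lattice: its points are the triples of natural numbers with a fixed sum (`d + 2` if
the monomials have degrees `d` and `d + 1`), and a unit triangle is given by its three vertices.
-/

/-- The unit triangle of a monomial of the larger degree `d + 1`, with exponent vector `n`;
its vertices are `n + e₀`, `n + e₁`, `n + e₂`. -/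
noncomputable def upperCell (n : Fin 3 →₀ ℕ) : Finset (Fin 3 →₀ ℕ) :=
  {n + Finsupp.single 0 1, n + Finsupp.single 1 1, n + Finsupp.single 2 1}

/-- The unit triangle (of the opposite orientation) of a monomial of the smaller degree `d`, with
exponent vector `m`; its vertices are `m + e₁ + e₂`, `m + e₀ + e₂`, `m + e₀ + e₁`. -/
noncomputable def lowerCell (m : Fin 3 →₀ ℕ) : Finset (Fin 3 →₀ ℕ) :=
  {m + Finsupp.single 1 1 + Finsupp.single 2 1, m + Finsupp.single 0 1 + Finsupp.single 2 1,
    m + Finsupp.single 0 1 + Finsupp.single 1 1}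

/-- The interlaced basis region of `[R/I]_d` and `[R/I]_{d+1}`, as its set of unit triangles. -/
noncomputable def region {K : Type*} [Field K] (I : Ideal (MvPolynomial (Fin 3) K)) (d : ℕ) :
    Finset (Finset (Fin 3 →₀ ℕ)) :=
  (basisMonomials I d).image lowerCell ∪ (basisMonomials I (d + 1)).image upperCell

/-- A lozenge in a region `H`: two distinct unit triangles of `H` that share an edge. -/
def IsLozenge (H : Finset (Finset (Fin 3 →₀ ℕ))) (L : Finset (Finset (Fin 3 →₀ ℕ))) : Prop :=
  ∃ t ∈ H, ∃ u ∈ H, t ≠ u ∧ (t ∩ u).card = 2 ∧ L = {t, u}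

/-- A lozenge tiling of `H`: a set of lozenges in `H` such that each unit triangle of `H` is
covered by exactly one of them. -/
def IsLozengeTiling (H : Finset (Finset (Fin 3 →₀ ℕ)))
    (T : Finset (Finset (Finset (Fin 3 →₀ ℕ)))) : Prop :=
  (∀ L ∈ T, IsLozenge H L) ∧ ∀ t ∈ H, ∃! L, L ∈ T ∧ t ∈ L

/-- The number of lozenge tilings of `H`. -/
noncomputable def numTilings (H : Finset (Finset (Fin 3 →₀ ℕ))) : ℕ :=
  {T | IsLozengeTiling H T}.ncard

end PuncturedHexagon

namespace PuncturedHexagon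

/-! Call the degree-`s` cells lower, the degree-`s+1` cells upper, and let the row of a cell be its
`x`-exponent. Edge-sharing cells have opposite orientations, and they share an edge exactly when one
monomial divides the other. So tilings are perfect matchings, which the permanent of the 0-1 matrix
`Z` counts. It equals `|det Z|` once all matchings have the same sign.

Read a matching as a permutation from lower to upper cells; it stays in a row or goes up by one.
Only upward steps start an inversion. If `u` steps leave a row of `n` lower cells, each starts a
number of inversions congruent to `u + n` mod 2, so the sign depends only on the `u`'s
(`inversions_eq`), which the region fixes (`upCount_add`). The congruence holds because lower row
`k` and upper row `k + 1` occupy the same `y`-positions, except that at `k + 1 = α` the puncture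
removes `M` consecutive ones, an even number (`even_row_sum`). -/

/-- A step from a lower cell `(r, y)` to an adjacent upper cell `(r', y')`, in coordinates given by
the first two exponents. -/
def IsStep (r y r' y' : ℕ) : Prop :=
  (r' = r + 1 ∧ y' = y) ∨ (r' = r ∧ (y' = y ∨ y' = y + 1))

/-! ### Signs of row-monotone matchings -/

section Sign

variable {h : ℕ} (r y r' y' : Fin h → ℕ)

/-- The number of steps from row `k` to row `k + 1`. -/
def upCount (σ : Equiv.Perm (Fin h)) (k : ℕ) : ℕ :=
  ∑ i, if r i = k ∧ r' (σ i) = r i + 1 then 1 else 0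

/-- A step never descends and rises at most one row, so the lower cells in rows up to `k` not
matched within those rows are exactly the ones stepping up from `k`. Hence `upCount` does not depend
on `σ`. -/
theorem upCount_add (σ : Equiv.Perm (Fin h))
    (hσ : ∀ i, IsStep (r i) (y i) (r' (σ i)) (y' (σ i))) (k : ℕ) :
    upCount r r' σ k + (∑ j, if r' j ≤ k then 1 else 0) = ∑ i, if r i ≤ k then 1 else 0 := by
  rw [← Equiv.sum_comp σ, upCount, ← Finset.sum_add_distrib]
  refine Finset.sum_congr rfl fun i _ => ?_
  have := hσ i
  unfold IsStep at this
  split_ifs <;> omega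

theorem sign_eq_neg_one_pow (σ : Equiv.Perm (Fin h)) :
    (Equiv.Perm.sign σ : ℤ) =
      (-1) ^ (∑ i, ∑ j, if i < j ∧ σ j < σ i then 1 else 0) := by
  rw [Equiv.Perm.sign_eq_prod_prod_Ioi]
  push_cast
  rw [← Finset.prod_pow_eq_pow_sum]
  refine Finset.prod_congr rfl fun i _ => ?_
  rw [← Finset.prod_pow_eq_pow_sum, ← Finset.prod_subset (Finset.subset_univ (Finset.Ioi i))]
  · refine Finset.prod_congr rfl fun j hj => ?_
    have hij : i < j := Finset.mem_Ioi.1 hj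
    have hne : σ i ≠ σ j := fun e => hij.ne (σ.injective e)
    by_cases hl : σ i < σ j
    · simp [hl, not_lt.2 hl.le]
    · simp [hl, hij, lt_of_le_of_ne (not_lt.1 hl) hne.symm]
  · intro j _ hj
    simp [show ¬ i < j from fun hh => hj (Finset.mem_Ioi.2 hh)]

/-- Inversions at `i` come from cells right of `i` in its row that do not step up, and from images
left of `σ i` whose source lies in row `r i + 1`. Adding all up-steps of the row completes both
counts; `i` itself gives the `+ 1`. -/
theorem inversions_of_up (hlt : ∀ i j, i < j ↔ r i < r j ∨ r i = r j ∧ y i < y j)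
    (hlt' : ∀ i j, i < j ↔ r' i < r' j ∨ r' i = r' j ∧ y' i < y' j) (σ : Equiv.Perm (Fin h))
    (hσ : ∀ i, IsStep (r i) (y i) (r' (σ i)) (y' (σ i))) (i : Fin h) (hi : r' (σ i) = r i + 1) :
    (∑ j, if i < j ∧ σ j < σ i then 1 else 0) + upCount r r' σ (r i) =
      (∑ j, if r j = r i ∧ y i < y j then 1 else 0) +
        (∑ j, if r' j = r i + 1 ∧ y' j < y' (σ i) then 1 else 0) + 1 := by
  -- Writing the `1` as an indicator of `j = i` makes the identity hold term by term in `j`.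
  have h1 : (1 : ℕ) = ∑ j, if j = i then 1 else 0 := by simp
  rw [← Equiv.sum_comp σ fun j => if r' j = r i + 1 ∧ y' j < y' (σ i) then 1 else 0, upCount]
  refine Eq.trans ?_ (congrArg (_ + ·) h1.symm)
  simp only [← Finset.sum_add_distrib]
  refine Finset.sum_congr rfl fun j _ => ?_
  have hi' := hσ i
  have hj := hσ j
  unfold IsStep at hi' hj
  by_cases hij : j = i
  · subst hij
    simp [hi]
  have := hlt i j
  have := hlt j i
  have := hlt' (σ j) (σ i)
  have : i < j ∨ j < i := by omega
  split_ifs <;> omega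

/-- Steps within a row shift `y` by at most one, so they cannot cross; all other later cells land in
higher rows. -/
theorem inversions_of_not_up (hlt : ∀ i j, i < j ↔ r i < r j ∨ r i = r j ∧ y i < y j)
    (hlt' : ∀ i j, i < j ↔ r' i < r' j ∨ r' i = r' j ∧ y' i < y' j) (σ : Equiv.Perm (Fin h))
    (hσ : ∀ i, IsStep (r i) (y i) (r' (σ i)) (y' (σ i))) (i : Fin h) (hi : r' (σ i) ≠ r i + 1) :
    (∑ j, if i < j ∧ σ j < σ i then 1 else 0) = 0 := by
  refine Finset.sum_eq_zero fun j _ => if_neg ?_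
  have hi' := hσ i
  have hj := hσ j
  unfold IsStep at hi' hj
  have := hlt i j
  have := hlt' (σ j) (σ i)
  omega

theorem inversions_eq (hlt : ∀ i j, i < j ↔ r i < r j ∨ r i = r j ∧ y i < y j)
    (hlt' : ∀ i j, i < j ↔ r' i < r' j ∨ r' i = r' j ∧ y' i < y' j)
    (heven : ∀ i j, r' j = r i + 1 → y' j = y i →
      Even ((∑ l, if r l = r i ∧ y i < y l then 1 else 0) +
        (∑ l, if r' l = r i + 1 ∧ y' l < y' j then 1 else 0) +
        (∑ l, if r l = r i then 1 else 0) + 1)) (σ : Equiv.Perm (Fin h))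
    (hσ : ∀ i, IsStep (r i) (y i) (r' (σ i)) (y' (σ i))) :
    ((∑ i, ∑ j, if i < j ∧ σ j < σ i then 1 else 0 : ℕ) : ZMod 2) =
      ∑ k ∈ Finset.univ.image r, (upCount r r' σ k : ZMod 2) *
        (upCount r r' σ k + (∑ l, if r l = k then 1 else 0 : ℕ)) := by
  have key : ∀ i, ((∑ j, if i < j ∧ σ j < σ i then 1 else 0 : ℕ) : ZMod 2) =
      (if r' (σ i) = r i + 1 then 1 else 0) *
        (upCount r r' σ (r i) + (∑ l, if r l = r i then 1 else 0 : ℕ)) := by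
    intro i
    by_cases hi : r' (σ i) = r i + 1
    · have h1 := inversions_of_up r y r' y' hlt hlt' σ hσ i hi
      have hy : y' (σ i) = y i := by
        have := hσ i
        unfold IsStep at this
        omega
      have h2 := heven i (σ i) hi hy
      rw [if_pos hi, one_mul, ← Nat.cast_add]
      refine (ZMod.natCast_eq_natCast_iff' _ _ 2).2 ?_
      rw [Nat.even_iff] at h2
      omega
    · rw [inversions_of_not_up r y r' y' hlt hlt' σ hσ i hi, if_neg hi]
      simp
  rw [Nat.cast_sum, Finset.sum_congr rfl fun i _ => key i,
    ← Finset.sum_fiberwise_of_maps_to (t := Finset.univ.image r) (g := r)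
      fun i _ => Finset.mem_image_of_mem r (Finset.mem_univ i)]
  refine Finset.sum_congr rfl fun k _ => ?_
  have : (upCount r r' σ k : ZMod 2) =
      ∑ i with r i = k, if r' (σ i) = r i + 1 then 1 else 0 := by
    rw [upCount, Finset.sum_filter, Nat.cast_sum]
    refine Finset.sum_congr rfl fun i _ => ?_
    split_ifs <;> simp_all
  rw [this, Finset.sum_mul, ← this]
  refine Finset.sum_congr rfl fun i hi => ?_
  rw [(Finset.mem_filter.1 hi).2]

/-- All perfect matchings of a region between two row-ordered lists of cells have the same sign,
provided every possible step to the next row meets an even number of other cells. -/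
theorem sign_eq_sign (hlt : ∀ i j, i < j ↔ r i < r j ∨ r i = r j ∧ y i < y j)
    (hlt' : ∀ i j, i < j ↔ r' i < r' j ∨ r' i = r' j ∧ y' i < y' j)
    (heven : ∀ i j, r' j = r i + 1 → y' j = y i →
      Even ((∑ l, if r l = r i ∧ y i < y l then 1 else 0) +
        (∑ l, if r' l = r i + 1 ∧ y' l < y' j then 1 else 0) +
        (∑ l, if r l = r i then 1 else 0) + 1)) (σ τ : Equiv.Perm (Fin h))
    (hσ : ∀ i, IsStep (r i) (y i) (r' (σ i)) (y' (σ i)))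
    (hτ : ∀ i, IsStep (r i) (y i) (r' (τ i)) (y' (τ i))) :
    Equiv.Perm.sign σ = Equiv.Perm.sign τ := by
  have hup : ∀ k, upCount r r' σ k = upCount r r' τ k := fun k =>
    Nat.add_right_cancel ((upCount_add r y r' y' σ hσ k).trans (upCount_add r y r' y' τ hτ k).symm)
  have hpar : ((∑ i, ∑ j, if i < j ∧ σ j < σ i then 1 else 0 : ℕ) : ZMod 2) =
      (∑ i, ∑ j, if i < j ∧ τ j < τ i then 1 else 0 : ℕ) := by
    rw [inversions_eq r y r' y' hlt hlt' heven σ hσ, inversions_eq r y r' y' hlt hlt' heven τ hτ]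
    simp only [hup]
  rw [ZMod.natCast_eq_natCast_iff'] at hpar
  refine Units.ext ?_
  rw [sign_eq_neg_one_pow, sign_eq_neg_one_pow, neg_one_pow_eq_pow_mod_two, hpar,
    ← neg_one_pow_eq_pow_mod_two]

end Sign

/-! ### Permanents, determinants and perfect matchings -/

theorem permanent_eq_abs_det {h : ℕ} (Z : Matrix (Fin h) (Fin h) ℤ)
    (h01 : ∀ i j, Z i j = 0 ∨ Z i j = 1)
    (hsign : ∀ σ τ : Equiv.Perm (Fin h), (∀ i, Z (σ i) i = 1) → (∀ i, Z (τ i) i = 1) →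
      Equiv.Perm.sign σ = Equiv.Perm.sign τ) :
    Z.permanent = |Z.det| := by
  have hzero : ∀ σ : Equiv.Perm (Fin h), (¬ ∀ i, Z (σ i) i = 1) → ∏ i, Z (σ i) i = 0 := by
    intro σ hσ
    obtain ⟨i, hi⟩ := not_forall.1 hσ
    exact Finset.prod_eq_zero (Finset.mem_univ i) ((h01 _ _).resolve_right hi)
  have hnonneg : 0 ≤ Z.permanent := Finset.sum_nonneg fun σ _ => Finset.prod_nonneg fun i _ => by
    rcases h01 (σ i) i with e | e <;> simp [e]
  by_cases hex : ∃ τ : Equiv.Perm (Fin h), ∀ i, Z (τ i) i = 1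
  · obtain ⟨τ, hτ⟩ := hex
    have hdet : Z.det = (Equiv.Perm.sign τ : ℤ) * Z.permanent := by
      rw [Matrix.det_apply', Matrix.permanent, Finset.mul_sum]
      refine Finset.sum_congr rfl fun σ _ => ?_
      by_cases hσ : ∀ i, Z (σ i) i = 1
      · rw [hsign σ τ hσ hτ]
        rfl
      · rw [hzero σ hσ, mul_zero, mul_zero]
    rw [hdet, abs_mul, abs_of_nonneg hnonneg]
    rcases Int.units_eq_one_or (Equiv.Perm.sign τ) with e | e <;> simp [e]
  · have h0 : ∀ σ : Equiv.Perm (Fin h), ∏ i, Z (σ i) i = 0 :=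
      fun σ => hzero σ fun hσ => hex ⟨σ, hσ⟩
    rw [Matrix.det_apply', Matrix.permanent]
    simp [h0]

theorem permanent_eq_card {h : ℕ} (Z : Matrix (Fin h) (Fin h) ℤ) (R : Fin h → Fin h → Prop)
    (hZ : ∀ i j, R i j → Z i j = 1) (hZ' : ∀ i j, ¬ R i j → Z i j = 0) :
    Z.permanent = ({σ : Equiv.Perm (Fin h) | ∀ i, R (σ i) i}.ncard : ℤ) := by
  classical
  rw [Set.ncard_eq_toFinset_card', Set.toFinset_ofPred, Finset.card_filter, Matrix.permanent]
  push_cast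
  refine Finset.sum_congr rfl fun σ _ => ?_
  split_ifs with hσ
  · exact Finset.prod_eq_one fun i _ => hZ _ _ (hσ i)
  · obtain ⟨i, hi⟩ := not_forall.1 hσ
    exact Finset.prod_eq_zero (Finset.mem_univ i) (hZ' _ _ hi)

/-- Tilings of a two-coloured region, listed as `P i` and `Q j`, are the permutations that respect
adjacency. -/
theorem numTilings_eq_ncard {h : ℕ} (P Q : Fin h → Finset (Fin 3 →₀ ℕ)) (R : Fin h → Fin h → Prop)
    (hP : Function.Injective P) (hQ : Function.Injective Q) (hPQ : ∀ i j, P i ≠ Q j)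
    (H : Finset (Finset (Fin 3 →₀ ℕ))) (hH : ∀ t, t ∈ H ↔ (∃ i, P i = t) ∨ ∃ j, Q j = t)
    (hloz : ∀ L, IsLozenge H L ↔ ∃ i j, R i j ∧ L = {P i, Q j}) :
    numTilings H = {σ : Equiv.Perm (Fin h) | ∀ i, R (σ i) i}.ncard := by
  classical
  have hpair : ∀ i j i' j', ({P i, Q j} : Finset (Finset (Fin 3 →₀ ℕ))) = {P i', Q j'} →
      i = i' ∧ j = j' := by
    intro i j i' j' e
    have h1 : P i ∈ ({P i', Q j'} : Finset _) := e ▸ Finset.mem_insert_self _ _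
    have h2 : Q j ∈ ({P i', Q j'} : Finset _) := e ▸ Finset.mem_insert_of_mem (by simp)
    simp only [Finset.mem_insert, Finset.mem_singleton, hPQ, or_false, (hPQ _ _).symm,
      false_or] at h1 h2
    exact ⟨hP h1, hQ h2⟩
  let F : Equiv.Perm (Fin h) → Finset (Finset (Finset (Fin 3 →₀ ℕ))) :=
    fun σ => Finset.univ.image fun i => {P (σ i), Q i}
  have hFmem : ∀ σ L, L ∈ F σ ↔ ∃ i, {P (σ i), Q i} = L := by simp [F]
  have hF : Function.Injective F := by
    intro σ τ e
    ext1 i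
    obtain ⟨j, hj⟩ := (hFmem τ _).1 (e ▸ (hFmem σ _).2 ⟨i, rfl⟩)
    obtain ⟨h1, h2⟩ := hpair _ _ _ _ hj
    rw [← h1, h2]
  rw [numTilings, ← Set.ncard_image_of_injective _ hF]
  congr 1
  ext T
  simp only [Set.mem_ofPred_eq, Set.mem_image]
  constructor
  · rintro ⟨hT, hcov⟩
    have hQT : ∀ j, ∃ i, R i j ∧ {P i, Q j} ∈ T := by
      intro j
      obtain ⟨L, ⟨hLT, hL⟩, -⟩ := hcov (Q j) ((hH _).2 (Or.inr ⟨j, rfl⟩))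
      obtain ⟨i, j', hR, rfl⟩ := (hloz L).1 (hT L hLT)
      simp only [Finset.mem_insert, Finset.mem_singleton, (hPQ _ _).symm, false_or] at hL
      obtain rfl := hQ hL
      exact ⟨i, hR, hLT⟩
    choose f hfR hfT using hQT
    -- Two tiles through the same `P` cell would coincide, so the choice is injective, hence
    -- bijective by finiteness.
    have hinj : Function.Injective f := by
      intro j j' e
      refine (hpair (f j) j (f j') j' ?_).2
      exact (hcov (P (f j)) ((hH _).2 (Or.inl ⟨_, rfl⟩))).unique ⟨hfT j, by simp⟩
        ⟨hfT j', by simp [e]⟩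
    refine ⟨Equiv.ofBijective f (Finite.injective_iff_bijective.1 hinj), hfR, ?_⟩
    ext L
    rw [hFmem]
    constructor
    · rintro ⟨i, rfl⟩
      exact hfT i
    · intro hL
      obtain ⟨i, j, -, rfl⟩ := (hloz L).1 (hT L hL)
      exact ⟨j, (hcov (Q j) ((hH _).2 (Or.inr ⟨j, rfl⟩))).unique ⟨hfT j, by simp⟩
        ⟨hL, by simp⟩⟩
  · rintro ⟨σ, hσ, rfl⟩
    refine ⟨fun L hL => ?_, fun t ht => ?_⟩
    · obtain ⟨i, rfl⟩ := (hFmem σ L).1 hL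
      exact (hloz _).2 ⟨σ i, i, hσ i, rfl⟩
    · rcases (hH t).1 ht with ⟨i, rfl⟩ | ⟨j, rfl⟩
      · refine ⟨{P i, Q (σ.symm i)}, ⟨(hFmem _ _).2 ⟨σ.symm i, by simp⟩, by simp⟩, ?_⟩
        rintro L ⟨hL, hi⟩
        obtain ⟨j, rfl⟩ := (hFmem σ L).1 hL
        simp only [Finset.mem_insert, Finset.mem_singleton, hPQ, or_false] at hi
        rw [hP hi, Equiv.symm_apply_apply]
      · refine ⟨{P (σ j), Q j}, ⟨(hFmem _ _).2 ⟨j, rfl⟩, by simp⟩, ?_⟩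
        rintro L ⟨hL, hi⟩
        obtain ⟨j', rfl⟩ := (hFmem σ L).1 hL
        simp only [Finset.mem_insert, Finset.mem_singleton, (hPQ _ _).symm, false_or] at hi
        rw [hQ hi]

/-! ### Monomials as exponent vectors -/

open MvPolynomial

theorem finsupp_ext_iff {m n : Fin 3 →₀ ℕ} : m = n ↔ m 0 = n 0 ∧ m 1 = n 1 ∧ m 2 = n 2 := by
  refine ⟨by rintro rfl; simp, fun ⟨h0, h1, h2⟩ => ?_⟩
  ext i
  fin_cases i <;> assumption

theorem finsupp_le_iff {m n : Fin 3 →₀ ℕ} : m ≤ n ↔ m 0 ≤ n 0 ∧ m 1 ≤ n 1 ∧ m 2 ≤ n 2 := by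
  rw [Finsupp.le_def, Fin.forall_fin_succ, Fin.forall_fin_succ, Fin.forall_fin_succ]
  simp

theorem mem_finsuppAntidiag_iff {m : Fin 3 →₀ ℕ} {d : ℕ} :
    m ∈ Finset.finsuppAntidiag Finset.univ d ↔ m 0 + m 1 + m 2 = d := by
  simp [Finset.mem_finsuppAntidiag, Fin.sum_univ_succ, add_assoc]

/-- The monomial with given exponents. -/
noncomputable def expVec (i j k : ℕ) : Fin 3 →₀ ℕ :=
  Finsupp.single 0 i + Finsupp.single 1 j + Finsupp.single 2 k

@[simp] theorem expVec_zero (i j k : ℕ) : expVec i j k 0 = i := by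
  simp [expVec]

@[simp] theorem expVec_one (i j k : ℕ) : expVec i j k 1 = j := by
  simp [expVec]

@[simp] theorem expVec_two (i j k : ℕ) : expVec i j k 2 = k := by
  simp [expVec]

theorem aciIdeal_eq_span (K : Type*) [Field K] (a b c α β γ : ℕ) :
    aciIdeal K a b c α β γ = Ideal.span ((fun v => monomial v (1 : K)) ''
      {expVec a 0 0, expVec 0 b 0, expVec 0 0 c, expVec α β γ}) := by
  rw [aciIdeal]
  congr 1
  simp [Set.image_insert_eq, expVec, X_pow_eq_monomial, monomial_mul]

theorem mem_basisMonomials {K : Type*} [Field K] {a b c α β γ d : ℕ} {m : Fin 3 →₀ ℕ} :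
    m ∈ basisMonomials (aciIdeal K a b c α β γ) d ↔
      m 0 + m 1 + m 2 = d ∧ m 0 < a ∧ m 1 < b ∧ m 2 < c ∧ ¬ (α ≤ m 0 ∧ β ≤ m 1 ∧ γ ≤ m 2) := by
  classical
  rw [basisMonomials, Finset.mem_filter, mem_finsuppAntidiag_iff, aciIdeal_eq_span,
    mem_ideal_span_monomial_image]
  simp [support_monomial, finsupp_le_iff]

/-! ### Lexicographic enumeration of the bases -/

section Enumeration

variable {K : Type*} [Field K] (I : Ideal (MvPolynomial (Fin 3) K)) (d : ℕ)

theorem basisMonomial_mem (i : Fin (hilb I d)) : basisMonomial I d i ∈ basisMonomials I d := by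
  obtain ⟨m, hm, e⟩ := Finset.mem_map.1 (Finset.orderEmbOfFin_mem
    ((basisMonomials I d).map toLex.toEmbedding) (Finset.card_map toLex.toEmbedding) i)
  have : basisMonomial I d i = m := congrArg ofLex e.symm
  rwa [this]

theorem exists_basisMonomial_eq {m : Fin 3 →₀ ℕ} (hm : m ∈ basisMonomials I d) :
    ∃ i, basisMonomial I d i = m := by
  have h : toLex m ∈ Set.range (((basisMonomials I d).map toLex.toEmbedding).orderEmbOfFin
      (Finset.card_map toLex.toEmbedding)) := by
    rw [Finset.range_orderEmbOfFin]
    exact Finset.mem_map_of_mem _ hm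
  obtain ⟨i, hi⟩ := h
  exact ⟨i, congrArg ofLex hi⟩

theorem basisMonomial_injective : Function.Injective (basisMonomial I d) := fun _ _ e =>
  (Finset.orderEmbOfFin _ _).injective (ofLex.injective e)

theorem basisMonomial_degree (i : Fin (hilb I d)) :
    basisMonomial I d i 0 + basisMonomial I d i 1 + basisMonomial I d i 2 = d := by
  classical
  have := basisMonomial_mem I d i
  rw [basisMonomials, Finset.mem_filter] at this
  exact mem_finsuppAntidiag_iff.1 this.1

/-- In a fixed degree the first two exponents determine the third. -/
theorem toLex_lt_iff {m n : Fin 3 →₀ ℕ} (hmn : m 0 + m 1 + m 2 = n 0 + n 1 + n 2) :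
    toLex m < toLex n ↔ m 0 < n 0 ∨ m 0 = n 0 ∧ m 1 < n 1 := by
  rw [Finsupp.Lex.lt_iff]
  simp only [Fin.exists_fin_succ, Fin.forall_fin_succ]
  simp
  omega

theorem lt_iff_basisMonomial (i j : Fin (hilb I d)) :
    i < j ↔ basisMonomial I d i 0 < basisMonomial I d j 0 ∨
      basisMonomial I d i 0 = basisMonomial I d j 0 ∧
        basisMonomial I d i 1 < basisMonomial I d j 1 := by
  rw [← toLex_lt_iff ((basisMonomial_degree I d i).trans (basisMonomial_degree I d j).symm)]
  exact (OrderEmbedding.lt_iff_lt (((basisMonomials I d).map toLex.toEmbedding).orderEmbOfFin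
    (Finset.card_map toLex.toEmbedding))).symm

/-- Turns a count over basis indices in one row into a count over `y`-exponents, so that rows of
different degrees can be compared pointwise. -/
theorem sum_row_eq (k N : ℕ) (hN : d < N) (φ ψ : ℕ → Prop) [DecidablePred φ] [DecidablePred ψ]
    (hψ : ∀ t, (∃ m ∈ basisMonomials I d, m 0 = k ∧ m 1 = t) ↔ ψ t) :
    (∑ l, if basisMonomial I d l 0 = k ∧ φ (basisMonomial I d l 1) then 1 else 0) =
      ∑ t ∈ Finset.range N, if ψ t ∧ φ t then 1 else 0 := by
  rw [← Finset.card_filter, ← Finset.card_filter]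
  refine Finset.card_bij (fun l _ => basisMonomial I d l 1) ?_ ?_ ?_
  · intro l hl
    have := basisMonomial_degree I d l
    simp only [Finset.mem_filter, Finset.mem_univ, true_and, Finset.mem_range] at hl ⊢
    exact ⟨by omega, (hψ _).1 ⟨_, basisMonomial_mem I d l, hl.1, rfl⟩, hl.2⟩
  · intro l hl l' hl' e
    simp only [Finset.mem_filter, Finset.mem_univ, true_and] at hl hl'
    have := basisMonomial_degree I d l
    have := basisMonomial_degree I d l'
    exact basisMonomial_injective I d (finsupp_ext_iff.2 ⟨by omega, e, by omega⟩)
  · intro y hy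
    simp only [Finset.mem_filter, Finset.mem_range, ← hψ] at hy
    obtain ⟨-, ⟨m, hm, h0, rfl⟩, hφ⟩ := hy
    obtain ⟨l, rfl⟩ := exists_basisMonomial_eq I d hm
    exact ⟨l, by simp [h0, hφ], rfl⟩

end Enumeration

/-! ### Geometry of unit triangles -/

section Cells

theorem mem_lowerCell {m v : Fin 3 →₀ ℕ} :
    v ∈ lowerCell m ↔ (v 0 = m 0 ∧ v 1 = m 1 + 1 ∧ v 2 = m 2 + 1) ∨
      (v 0 = m 0 + 1 ∧ v 1 = m 1 ∧ v 2 = m 2 + 1) ∨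
      (v 0 = m 0 + 1 ∧ v 1 = m 1 + 1 ∧ v 2 = m 2) := by
  simp [lowerCell, finsupp_ext_iff]

theorem mem_upperCell {n v : Fin 3 →₀ ℕ} :
    v ∈ upperCell n ↔ (v 0 = n 0 + 1 ∧ v 1 = n 1 ∧ v 2 = n 2) ∨
      (v 0 = n 0 ∧ v 1 = n 1 + 1 ∧ v 2 = n 2) ∨
      (v 0 = n 0 ∧ v 1 = n 1 ∧ v 2 = n 2 + 1) := by
  simp [upperCell, finsupp_ext_iff]

/-- An edge lies in only one triangle of each orientation, so lozenges pair opposite orientations.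
-/
theorem eq_of_lowerCell_inter {m m' v w : Fin 3 →₀ ℕ} (hvw : v ≠ w)
    (hv : v ∈ lowerCell m) (hw : w ∈ lowerCell m) (hv' : v ∈ lowerCell m')
    (hw' : w ∈ lowerCell m') : m = m' := by
  rw [mem_lowerCell] at *
  rw [Ne, finsupp_ext_iff] at hvw
  rw [finsupp_ext_iff]
  omega

theorem eq_of_upperCell_inter {m m' v w : Fin 3 →₀ ℕ} (hvw : v ≠ w)
    (hv : v ∈ upperCell m) (hw : w ∈ upperCell m) (hv' : v ∈ upperCell m')
    (hw' : w ∈ upperCell m') : m = m' := by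
  rw [mem_upperCell] at *
  rw [Ne, finsupp_ext_iff] at hvw
  rw [finsupp_ext_iff]
  omega

theorem le_of_cells_inter {m n v w : Fin 3 →₀ ℕ} (hvw : v ≠ w)
    (hv : v ∈ lowerCell m) (hw : w ∈ lowerCell m) (hv' : v ∈ upperCell n)
    (hw' : w ∈ upperCell n) : m ≤ n := by
  rw [mem_lowerCell] at hv hw
  rw [mem_upperCell] at hv' hw'
  rw [Ne, finsupp_ext_iff] at hvw
  rw [finsupp_le_iff]
  omega

theorem exists_mem_of_card_two {s t : Finset (Fin 3 →₀ ℕ)} (h : (s ∩ t).card = 2) :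
    ∃ v w, v ≠ w ∧ v ∈ s ∧ w ∈ s ∧ v ∈ t ∧ w ∈ t := by
  obtain ⟨v, w, hvw, e⟩ := Finset.card_eq_two.1 h
  have hv : v ∈ s ∩ t := by simp [e]
  have hw : w ∈ s ∩ t := by simp [e]
  rw [Finset.mem_inter] at hv hw
  exact ⟨v, w, hvw, hv.1, hw.1, hv.2, hw.2⟩

theorem card_cells_inter {m n : Fin 3 →₀ ℕ} (hd : n 0 + n 1 + n 2 = m 0 + m 1 + m 2 + 1)
    (hmn : m ≤ n) : (lowerCell m ∩ upperCell n).card = 2 := by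
  rw [finsupp_le_iff] at hmn
  rw [Finset.card_eq_two]
  have h : (n 0 = m 0 + 1 ∧ n 1 = m 1 ∧ n 2 = m 2) ∨ (n 0 = m 0 ∧ n 1 = m 1 + 1 ∧ n 2 = m 2) ∨
      (n 0 = m 0 ∧ n 1 = m 1 ∧ n 2 = m 2 + 1) := by omega
  rcases h with h | h | h
  -- If `n = m + eᵢ`, the shared edge joins the vertices `n + eⱼ` with `j ≠ i`.
  · refine ⟨expVec (n 0) (n 1 + 1) (n 2), expVec (n 0) (n 1) (n 2 + 1), ?_, ?_⟩
    · simp [finsupp_ext_iff]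
    · ext v
      simp only [Finset.mem_inter, mem_lowerCell, mem_upperCell, Finset.mem_insert,
        Finset.mem_singleton, finsupp_ext_iff, expVec_zero, expVec_one, expVec_two]
      omega
  · refine ⟨expVec (n 0 + 1) (n 1) (n 2), expVec (n 0) (n 1) (n 2 + 1), ?_, ?_⟩
    · simp [finsupp_ext_iff]
    · ext v
      simp only [Finset.mem_inter, mem_lowerCell, mem_upperCell, Finset.mem_insert,
        Finset.mem_singleton, finsupp_ext_iff, expVec_zero, expVec_one, expVec_two]
      omega
  · refine ⟨expVec (n 0 + 1) (n 1) (n 2), expVec (n 0) (n 1 + 1) (n 2), ?_, ?_⟩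
    · simp [finsupp_ext_iff]
    · ext v
      simp only [Finset.mem_inter, mem_lowerCell, mem_upperCell, Finset.mem_insert,
        Finset.mem_singleton, finsupp_ext_iff, expVec_zero, expVec_one, expVec_two]
      omega

theorem lowerCell_injective : Function.Injective lowerCell := by
  intro m m' e
  have h1 : expVec (m 0 + 1) (m 1 + 1) (m 2) ∈ lowerCell m := by simp [mem_lowerCell]
  have h2 : expVec (m 0 + 1) (m 1) (m 2 + 1) ∈ lowerCell m := by simp [mem_lowerCell]
  exact eq_of_lowerCell_inter (by simp [finsupp_ext_iff]) h1 h2 (e ▸ h1) (e ▸ h2)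

theorem upperCell_injective : Function.Injective upperCell := by
  intro m m' e
  have h1 : expVec (m 0 + 1) (m 1) (m 2) ∈ upperCell m := by simp [mem_upperCell]
  have h2 : expVec (m 0) (m 1 + 1) (m 2) ∈ upperCell m := by simp [mem_upperCell]
  exact eq_of_upperCell_inter (by simp [finsupp_ext_iff]) h1 h2 (e ▸ h1) (e ▸ h2)

theorem lowerCell_ne_upperCell (m n : Fin 3 →₀ ℕ) : lowerCell m ≠ upperCell n := by
  intro e
  have h1 : expVec (m 0 + 1) (m 1 + 1) (m 2) ∈ lowerCell m := by simp [mem_lowerCell]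
  have h2 : expVec (m 0 + 1) (m 1) (m 2 + 1) ∈ lowerCell m := by simp [mem_lowerCell]
  have h3 : expVec (m 0) (m 1 + 1) (m 2 + 1) ∈ lowerCell m := by simp [mem_lowerCell]
  rw [e, mem_upperCell] at h1 h2 h3
  simp only [expVec_zero, expVec_one, expVec_two] at h1 h2 h3
  omega

end Cells

/-! ### Lozenge tilings and the permanent -/

theorem mem_region_iff {K : Type*} [Field K] (I : Ideal (MvPolynomial (Fin 3) K)) (d : ℕ)
    (t : Finset (Fin 3 →₀ ℕ)) :
    t ∈ region I d ↔ (∃ i, lowerCell (basisMonomial I d i) = t) ∨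
      ∃ j, upperCell (basisMonomial I (d + 1) j) = t := by
  rw [region, Finset.mem_union, Finset.mem_image, Finset.mem_image]
  refine or_congr ⟨?_, fun ⟨i, e⟩ => ⟨_, basisMonomial_mem I d i, e⟩⟩
    ⟨?_, fun ⟨i, e⟩ => ⟨_, basisMonomial_mem I (d + 1) i, e⟩⟩
  all_goals
    rintro ⟨m, hm, e⟩
    obtain ⟨i, rfl⟩ := exists_basisMonomial_eq I _ hm
    exact ⟨i, e⟩

theorem isLozenge_region_iff {K : Type*} [Field K] (I : Ideal (MvPolynomial (Fin 3) K)) (d : ℕ)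
    (L : Finset (Finset (Fin 3 →₀ ℕ))) :
    IsLozenge (region I d) L ↔ ∃ i j, basisMonomial I d i ≤ basisMonomial I (d + 1) j ∧
      L = {lowerCell (basisMonomial I d i), upperCell (basisMonomial I (d + 1) j)} := by
  constructor
  · rintro ⟨t, ht, u, hu, hne, hc, rfl⟩
    obtain ⟨v, w, hvw, h1, h2, h3, h4⟩ := exists_mem_of_card_two hc
    rcases (mem_region_iff I d t).1 ht with ⟨i, rfl⟩ | ⟨i, rfl⟩ <;> rcases (mem_region_iff I d u).1 hu with ⟨j, rfl⟩ | ⟨j, rfl⟩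
    · exact absurd (congrArg lowerCell (eq_of_lowerCell_inter hvw h1 h2 h3 h4)) hne
    · exact ⟨i, j, le_of_cells_inter hvw h1 h2 h3 h4, rfl⟩
    · exact ⟨j, i, le_of_cells_inter hvw h3 h4 h1 h2, Finset.pair_comm _ _⟩
    · exact absurd (congrArg upperCell (eq_of_upperCell_inter hvw h1 h2 h3 h4)) hne
  · rintro ⟨i, j, hij, rfl⟩
    refine ⟨_, (mem_region_iff I d _).2 (Or.inl ⟨i, rfl⟩), _, (mem_region_iff I d _).2 (Or.inr ⟨j, rfl⟩),
      lowerCell_ne_upperCell _ _, card_cells_inter ?_ hij, rfl⟩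
    rw [basisMonomial_degree, basisMonomial_degree]

theorem permanent_eq_numTilings {K : Type*} [Field K] (I : Ideal (MvPolynomial (Fin 3) K)) (d : ℕ)
    (h : hilb I (d + 1) = hilb I d) :
    (zMatrix I d h).permanent = (numTilings (region I d) : ℤ) := by
  classical
  rw [permanent_eq_card (zMatrix I d h)
    (fun i j => basisMonomial I d i ≤ basisMonomial I (d + 1) (Fin.cast h.symm j))
    (fun i j hij => by simp [zMatrix, zRect, hij]) (fun i j hij => by simp [zMatrix, zRect, hij])]
  rw [numTilings_eq_ncard (fun i => lowerCell (basisMonomial I d i))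
    (fun j => upperCell (basisMonomial I (d + 1) (Fin.cast h.symm j)))
    (fun i j => basisMonomial I d i ≤ basisMonomial I (d + 1) (Fin.cast h.symm j))]
  · exact lowerCell_injective.comp (basisMonomial_injective I d)
  · exact upperCell_injective.comp ((basisMonomial_injective I (d + 1)).comp
      (Fin.cast_injective h.symm))
  · exact fun i j => lowerCell_ne_upperCell _ _
  · intro t
    rw [mem_region_iff]
    refine or_congr_right ⟨?_, fun ⟨j, e⟩ => ⟨_, e⟩⟩
    rintro ⟨j, e⟩
    obtain ⟨j, rfl⟩ : ∃ j', Fin.cast h.symm j' = j := ⟨Fin.cast h j, by simp⟩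
    exact ⟨j, e⟩
  · intro L
    rw [isLozenge_region_iff]
    constructor
    · rintro ⟨i, j, hij, rfl⟩
      obtain ⟨j, rfl⟩ : ∃ j', Fin.cast h.symm j' = j := ⟨Fin.cast h j, by simp⟩
      exact ⟨i, j, hij, rfl⟩
    · rintro ⟨i, j, hij, rfl⟩
      exact ⟨i, _, hij, rfl⟩

/-! ### Equality of the two Hilbert function values -/

section Hilbert

/-- The number of monomials of degree `d` that are multiples of `x^p y^q z^w`. -/
noncomputable def multiplesCount (d p q w : ℕ) : ℕ :=
  ∑ m ∈ Finset.finsuppAntidiag (Finset.univ : Finset (Fin 3)) d,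
    if p ≤ m 0 ∧ q ≤ m 1 ∧ w ≤ m 2 then 1 else 0

/-- Multiplication by `x` reaches the multiples with `x`-exponent above `p`; those with exponent
exactly `p` are the increment, truncated to `0` when the degree is too small. -/
theorem multiplesCount_succ (d p q w : ℕ) :
    multiplesCount (d + 1) p q w = multiplesCount d p q w + (d + 2 - (p + q + w)) := by
  have h1 : multiplesCount d p q w = multiplesCount (d + 1) (p + 1) q w := by
    rw [multiplesCount, multiplesCount, ← Finset.card_filter, ← Finset.card_filter]
    refine Finset.card_bij (fun m _ => m + expVec 1 0 0) ?_ ?_ ?_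
    · intro m hm
      simp only [Finset.mem_filter, mem_finsuppAntidiag_iff, Finsupp.add_apply, expVec_zero,
        expVec_one, expVec_two] at hm ⊢
      omega
    · intro m _ m' _ e
      exact add_right_cancel e
    · intro n hn
      simp only [Finset.mem_filter, mem_finsuppAntidiag_iff] at hn
      refine ⟨expVec (n 0 - 1) (n 1) (n 2), ?_, ?_⟩
      · simp only [Finset.mem_filter, mem_finsuppAntidiag_iff, expVec_zero, expVec_one, expVec_two]
        omega
      · simp only [finsupp_ext_iff, Finsupp.add_apply, expVec_zero, expVec_one, expVec_two]
        omega
  have h2 : (d + 2 - (p + q + w)) =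
      ∑ m ∈ Finset.finsuppAntidiag (Finset.univ : Finset (Fin 3)) (d + 1),
        if p = m 0 ∧ q ≤ m 1 ∧ w ≤ m 2 then 1 else 0 := by
    rw [← Finset.card_filter, ← Finset.card_range (d + 2 - (p + q + w))]
    refine Finset.card_bij (fun t _ => expVec p (q + t) (d + 1 - p - q - t)) ?_ ?_ ?_
    · intro t ht
      simp only [Finset.mem_filter, mem_finsuppAntidiag_iff, expVec_zero, expVec_one,
        expVec_two, Finset.mem_range, true_and] at ht ⊢
      omega
    · intro t _ t' _ e
      simp only [finsupp_ext_iff, expVec_one] at e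
      omega
    · intro n hn
      simp only [Finset.mem_filter, mem_finsuppAntidiag_iff] at hn
      refine ⟨n 1 - q, ?_, ?_⟩
      · rw [Finset.mem_range]
        omega
      · simp only [finsupp_ext_iff, expVec_zero, expVec_one, expVec_two]
        omega
  rw [h1, h2, multiplesCount, multiplesCount, ← Finset.sum_add_distrib]
  refine Finset.sum_congr rfl fun m _ => ?_
  split_ifs <;> omega

/-- The bounds make any common multiple of two generators have degree above `d`, so
inclusion-exclusion has no correction terms. -/
theorem hilb_add_multiplesCount {K : Type*} [Field K] {a b c α β γ d : ℕ}
    (hab : d < a + b) (hac : d < a + c) (hbc : d < b + c)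
    (ha : d < a + β + γ) (hb : d < b + α + γ) (hc : d < c + α + β) :
    hilb (aciIdeal K a b c α β γ) d + (multiplesCount d a 0 0 + multiplesCount d 0 b 0 +
      multiplesCount d 0 0 c + multiplesCount d α β γ) = multiplesCount d 0 0 0 := by
  classical
  have h1 : hilb (aciIdeal K a b c α β γ) d =
      ∑ m ∈ Finset.finsuppAntidiag (Finset.univ : Finset (Fin 3)) d,
        if m 0 < a ∧ m 1 < b ∧ m 2 < c ∧ ¬ (α ≤ m 0 ∧ β ≤ m 1 ∧ γ ≤ m 2) then 1 else 0 := by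
    rw [← Finset.card_filter, hilb]
    congr 1
    ext m
    rw [mem_basisMonomials, Finset.mem_filter, mem_finsuppAntidiag_iff]
  rw [h1]
  simp only [multiplesCount, ← Finset.sum_add_distrib]
  refine Finset.sum_congr rfl fun m hm => ?_
  rw [mem_finsuppAntidiag_iff] at hm
  split_ifs <;> omega

end Hilbert

/-! ### Parity of rows, where the puncture enters -/

section Parity

/-- Without the puncture, right part, left part and the cell itself make up the whole row, so the
sum is twice the row size. `hb` and `hc` keep the puncture's edge inside the row. -/
theorem even_row_sum {K : Type*} [Field K] {a b c α β γ s M : ℕ} (hα : α < a)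
    (hb : s + 2 ≤ b + α + γ) (hc : s + 2 ≤ c + α + β)
    (hM : α + β + γ + M = s + 2) (heven : Even M)
    {m n : Fin 3 →₀ ℕ} (hm : m ∈ basisMonomials (aciIdeal K a b c α β γ) s)
    (hn : n ∈ basisMonomials (aciIdeal K a b c α β γ) (s + 1)) (h0 : n 0 = m 0 + 1)
    (h1 : n 1 = m 1) :
    Even ((∑ l, if basisMonomial (aciIdeal K a b c α β γ) s l 0 = m 0 ∧
          m 1 < basisMonomial (aciIdeal K a b c α β γ) s l 1 then 1 else 0) +
        (∑ l, if basisMonomial (aciIdeal K a b c α β γ) (s + 1) l 0 = m 0 + 1 ∧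
          basisMonomial (aciIdeal K a b c α β γ) (s + 1) l 1 < n 1 then 1 else 0) +
        (∑ l, if basisMonomial (aciIdeal K a b c α β γ) s l 0 = m 0 then 1 else 0) + 1) := by
  classical
  have hlow : ∀ t, (∃ m' ∈ basisMonomials (aciIdeal K a b c α β γ) s, m' 0 = m 0 ∧ m' 1 = t) ↔
      m 0 + t ≤ s ∧ m 0 < a ∧ t < b ∧ s < m 0 + t + c ∧
        ¬ (α ≤ m 0 ∧ β ≤ t ∧ m 0 + t + γ ≤ s) := by
    intro t
    constructor
    · rintro ⟨m', hm', e, rfl⟩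
      rw [mem_basisMonomials] at hm'
      omega
    · intro ht
      refine ⟨expVec (m 0) t (s - m 0 - t), ?_, by simp, by simp⟩
      simp only [mem_basisMonomials, expVec_zero, expVec_one, expVec_two]
      omega
  have hupp : ∀ t, (∃ n' ∈ basisMonomials (aciIdeal K a b c α β γ) (s + 1),
        n' 0 = m 0 + 1 ∧ n' 1 = t) ↔
      m 0 + t ≤ s ∧ m 0 + 1 < a ∧ t < b ∧ s < m 0 + t + c ∧
        ¬ (α ≤ m 0 + 1 ∧ β ≤ t ∧ m 0 + t + γ ≤ s) := by
    intro t
    constructor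
    · rintro ⟨m', hm', e, rfl⟩
      rw [mem_basisMonomials] at hm'
      omega
    · intro ht
      refine ⟨expVec (m 0 + 1) t (s - m 0 - t), ?_, by simp, by simp⟩
      simp only [mem_basisMonomials, expVec_zero, expVec_one, expVec_two]
      omega
  have hrow := sum_row_eq _ s (m 0) (s + 2) (by omega) (fun _ => True) _ hlow
  have hrow1 := sum_row_eq _ s (m 0) (s + 2) (by omega) (fun t => m 1 < t) _ hlow
  have hrow2 := sum_row_eq _ (s + 1) (m 0 + 1) (s + 2) (by omega) (fun t => t < n 1) _ hupp
  simp only [and_true] at hrow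
  rw [hrow, hrow1, hrow2]
  rw [mem_basisMonomials] at hm hn
  have hone : (1 : ℕ) = ∑ t ∈ Finset.range (s + 2), if t = m 1 then 1 else 0 := by
    rw [Finset.sum_ite_eq', if_pos (Finset.mem_range.2 (by omega))]
  -- Positions lost to the puncture left of `m 1`. Since `n` is not in the ideal, `m 1` avoids the
  -- edge `[β, β + M)`, so all `M` positions or none are lost.
  have hhole : Even (∑ t ∈ Finset.range (s + 2),
      if m 0 + 1 = α ∧ β ≤ t ∧ m 0 + t + γ ≤ s ∧ t < m 1 then 1 else 0) := by
    by_cases hcase : m 0 + 1 = α ∧ β ≤ m 1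
    · rw [← Finset.card_filter]
      have : Finset.filter (fun t => m 0 + 1 = α ∧ β ≤ t ∧ m 0 + t + γ ≤ s ∧ t < m 1)
          (Finset.range (s + 2)) = Finset.Ico β (β + M) := by
        ext t
        rw [Finset.mem_filter, Finset.mem_range, Finset.mem_Ico]
        omega
      rw [this, Nat.card_Ico, Nat.add_sub_cancel_left]
      exact heven
    · rw [Finset.sum_eq_zero]
      · exact Even.zero
      · intro t _
        rw [if_neg]
        omega
  have hsum : (∑ t ∈ Finset.range (s + 2), if (m 0 + t ≤ s ∧ m 0 < a ∧ t < b ∧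
        s < m 0 + t + c ∧ ¬ (α ≤ m 0 ∧ β ≤ t ∧ m 0 + t + γ ≤ s)) ∧ m 1 < t then 1 else 0) +
      (∑ t ∈ Finset.range (s + 2), if (m 0 + t ≤ s ∧ m 0 + 1 < a ∧ t < b ∧
        s < m 0 + t + c ∧ ¬ (α ≤ m 0 + 1 ∧ β ≤ t ∧ m 0 + t + γ ≤ s)) ∧ t < n 1 then 1 else 0) +
      (∑ t ∈ Finset.range (s + 2), if t = m 1 then 1 else 0) +
      (∑ t ∈ Finset.range (s + 2),
        if m 0 + 1 = α ∧ β ≤ t ∧ m 0 + t + γ ≤ s ∧ t < m 1 then 1 else 0) =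
      ∑ t ∈ Finset.range (s + 2), if m 0 + t ≤ s ∧ m 0 < a ∧ t < b ∧
        s < m 0 + t + c ∧ ¬ (α ≤ m 0 ∧ β ≤ t ∧ m 0 + t + γ ≤ s) then 1 else 0 := by
    simp only [← Finset.sum_add_distrib]
    refine Finset.sum_congr rfl fun t _ => ?_
    split_ifs <;> omega
  rw [← hone] at hsum
  rw [Nat.even_iff] at hhole ⊢
  omega

end Parity

end PuncturedHexagon

/-! ### The main theorem -/

open PuncturedHexagon in
theorem mainTheorem12 (K : Type*) [Field K] (a b c α β γ s A B C M : ℕ)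
    (hα : α < a) (hβ : β < b) (hγ : γ < c)
    (hαβ : α ≠ 0 ∨ β ≠ 0) (hαγ : α ≠ 0 ∨ γ ≠ 0) (hβγ : β ≠ 0 ∨ γ ≠ 0)
    (hs : a + b + c + α + β + γ = 3 * (s + 2))
    (hA : a + A = s + 2) (hB : b + B = s + 2) (hC : c + C = s + 2)
    (hM : α + β + γ + M = s + 2)
    (hA' : A ≤ β + γ) (hB' : B ≤ α + γ) (hC' : C ≤ α + β) :
    ∃ h : PuncturedHexagon.hilb (PuncturedHexagon.aciIdeal K a b c α β γ) (s + 1) =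
        PuncturedHexagon.hilb (PuncturedHexagon.aciIdeal K a b c α β γ) s,
      (PuncturedHexagon.zMatrix (PuncturedHexagon.aciIdeal K a b c α β γ) s h).permanent =
        (PuncturedHexagon.numTilings
          (PuncturedHexagon.region (PuncturedHexagon.aciIdeal K a b c α β γ) s) : ℤ) ∧
      (Even M →
        (PuncturedHexagon.zMatrix (PuncturedHexagon.aciIdeal K a b c α β γ) s h).permanent =
          |(PuncturedHexagon.zMatrix (PuncturedHexagon.aciIdeal K a b c α β γ) s h).det|) := by
  -- The increments cancel because `A + B + C + M = s + 2`.
  have h : hilb (aciIdeal K a b c α β γ) (s + 1) = hilb (aciIdeal K a b c α β γ) s := by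
    have h1 := hilb_add_multiplesCount (K := K) (d := s) (a := a) (b := b) (c := c) (α := α)
      (β := β) (γ := γ) (by omega) (by omega) (by omega) (by omega) (by omega) (by omega)
    have h2 := hilb_add_multiplesCount (K := K) (d := s + 1) (a := a) (b := b) (c := c) (α := α)
      (β := β) (γ := γ) (by omega) (by omega) (by omega) (by omega) (by omega) (by omega)
    simp only [multiplesCount_succ] at h2
    omega
  refine ⟨h, permanent_eq_numTilings _ s h, fun heven => ?_⟩
  set I := aciIdeal K a b c α β γ with hI
  refine permanent_eq_abs_det _ (fun i j => ?_) fun σ τ hσ hτ => ?_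
  · simp only [zMatrix, zRect, Matrix.submatrix_apply, Matrix.of_apply]
    split_ifs <;> simp
  -- The permutations in `permanent` send columns to rows, so the matching from lower to upper cells
  -- is the inverse.
  have hle : ∀ ρ : Equiv.Perm (Fin (hilb I s)), (∀ i, zMatrix I s h (ρ i) i = 1) →
      ∀ i, IsStep (basisMonomial I s i 0) (basisMonomial I s i 1)
        (basisMonomial I (s + 1) (Fin.cast h.symm (ρ⁻¹ i)) 0)
        (basisMonomial I (s + 1) (Fin.cast h.symm (ρ⁻¹ i)) 1) := by
    intro ρ hρ i
    have h1 := hρ (ρ⁻¹ i)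
    simp only [zMatrix, zRect, Matrix.submatrix_apply, Matrix.of_apply, id,
      show ρ (ρ⁻¹ i) = i from ρ.apply_symm_apply i, ite_eq_left_iff, zero_ne_one, imp_false, not_not, finsupp_le_iff] at h1
    have := basisMonomial_degree I s i
    have := basisMonomial_degree I (s + 1) (Fin.cast h.symm (ρ⁻¹ i))
    unfold IsStep
    omega
  rw [← Equiv.Perm.sign_inv σ, ← Equiv.Perm.sign_inv τ]
  refine sign_eq_sign (fun i => basisMonomial I s i 0) (fun i => basisMonomial I s i 1)
    (fun i => basisMonomial I (s + 1) (Fin.cast h.symm i) 0)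
    (fun i => basisMonomial I (s + 1) (Fin.cast h.symm i) 1) (lt_iff_basisMonomial I s)
    (fun i j => ?_) (fun i j h0 h1 => ?_) _ _ (hle σ hσ) (hle τ hτ)
  · exact (Fin.castOrderIso h.symm).lt_iff_lt.symm.trans (lt_iff_basisMonomial I (s + 1) _ _)
  · have key := even_row_sum hα (by omega) (by omega) hM heven (basisMonomial_mem I s i)
      (basisMonomial_mem I (s + 1) (Fin.cast h.symm j)) h0 h1
    rw [← Equiv.sum_comp (finCongr h.symm) fun l => if basisMonomial I (s + 1) l 0 =
      basisMonomial I s i 0 + 1 ∧ basisMonomial I (s + 1) l 1 <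
        basisMonomial I (s + 1) (Fin.cast h.symm j) 1 then 1 else 0] at key
    exact key
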